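/- A gyrogroup is a set $G$ with a binary operation $\oplus$ such that: there is a unique element $0$ with $0\oplus x=x=x\oplus 0$ for all $x$; every $x$ has a unique inverse $\ominus x$ with $\ominus x\oplus x=0=x\oplus(\ominus x)$; for all $x,y\in G$ there is an automorphism $\mathrm{gyr}[x,y]$ of $(G,\oplus)$ with $x\oplus(y\oplus z)=(x\oplus y)\oplus \mathrm{gyr}[x,y](z)$ for all $z$; and $\mathrm{gyr}[x\oplus y,y]=\mathrm{gyr}[x,y]$ for all $x,y$. A subgyrogroup is a nonempty subset that is closed under $\oplus$ and is a gyrogroup under the restricted operation (equivalently, a nonempty subset closed under $\oplus$ and $\ominus$); $\langle S\rangle$ denotes the smallest subgyrogroup containing $S\subseteq G$. A topological gyrogroup is a gyrogroup with a topology, here assumed Hausdorff, for which $\oplus\colon G\times G\to G$ and $\ominus\colon G\to G$ are continuous. Theorem. Let $G$ be a (Hausdorff) topological gyrogroup, and suppose that there is an open subset $U\subseteq G$ with compact closure such that $\langle U\rangle=G$. Then $G$ has a suitable set, that is, a subset $S\subseteq G$ such that $S$ is discrete in the subspace topology, $\langle S\rangle$ is dense in $G$, and $S\cup\{0\}$ is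 closed in $G$. -/

import Mathlib

/-- A gyrogroup, written additively: `x + y` is `x ⊕ y`, `-x` is `⊖ x`, and `gyr x y` is the
gyroautomorphism `gyr[x, y]`, an automorphism of the groupoid `(G, ⊕)`. The operations `0`, `-` and
`gyr` are determined by `⊕`; see `Gyrogroup.eq_zero_of_identity`, `Gyrogroup.eq_neg_of_add_eq_zero`
and `Gyrogroup.gyr_unique`. -/
class Gyrogroup (G : Type*) extends Add G, Zero G, Neg G where
  gyr : G → G → (G ≃+ G)
  protected zero_add : ∀ x : G, 0 + x = x
  protected add_zero : ∀ x : G, x + 0 = x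
  protected neg_add_self : ∀ x : G, -x + x = 0
  protected add_neg_self : ∀ x : G, x + -x = 0
  /-- The left gyroassociative law. -/
  add_gyroassoc : ∀ x y z : G, x + (y + z) = (x + y) + gyr x y z
  /-- The left loop property. -/
  gyr_loop : ∀ x y : G, gyr (x + y) y = gyr x y

namespace Gyrogroup

theorem left_cancel {G : Type*} [Gyrogroup G] {x y z : G} (h : x + y = x + z) : y = z := by
  have h' : -x + (x + y) = -x + (x + z) := by rw [h]
  rw [add_gyroassoc, add_gyroassoc, Gyrogroup.neg_add_self, Gyrogroup.zero_add,
    Gyrogroup.zero_add] at h'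
  exact (gyr (-x) x).injective h'

/-- The identity element is unique. -/
theorem eq_zero_of_identity {G : Type*} [Gyrogroup G] {e : G}
    (h : ∀ x : G, e + x = x ∧ x + e = x) : e = 0 := by
  rw [← Gyrogroup.add_zero e, (h 0).1]

/-- Inverses are unique. -/
theorem eq_neg_of_add_eq_zero {G : Type*} [Gyrogroup G] {x y : G} (h : x + y = 0) : y = -x :=
  left_cancel (h.trans (Gyrogroup.add_neg_self x).symm)

/-- Gyroautomorphisms are determined by the left gyroassociative law. -/
theorem gyr_unique {G : Type*} [Gyrogroup G] {x y : G} {f : G → G}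
    (h : ∀ z : G, x + (y + z) = (x + y) + f z) : f = gyr x y :=
  funext fun z => left_cancel ((h z).symm.trans (add_gyroassoc x y z))

/-- A subgyrogroup: a nonempty subset closed under `⊕` and `⊖`. Equivalently, a nonempty subset
closed under `⊕` which is a gyrogroup under the restricted operation; see
`Gyrogroup.isSubgyrogroup_iff`. -/
structure IsSubgyrogroup {G : Type*} [Gyrogroup G] (H : Set G) : Prop where
  nonempty : H.Nonempty
  add_mem : ∀ x ∈ H, ∀ y ∈ H, x + y ∈ H
  neg_mem : ∀ x ∈ H, -x ∈ H

theorem IsSubgyrogroup.zero_mem {G : Type*} [Gyrogroup G] {H : Set G} (hH : IsSubgyrogroup H) :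
    (0 : G) ∈ H := by
  obtain ⟨x, hx⟩ := hH.nonempty
  have h := hH.add_mem _ (hH.neg_mem x hx) x hx
  rwa [Gyrogroup.neg_add_self] at h

theorem neg_add_add {G : Type*} [Gyrogroup G] (x y : G) : -x + (x + y) = y := by
  have h0 : gyr (-x) x = gyr 0 x := by
    rw [← gyr_loop (-x) x, Gyrogroup.neg_add_self]
  have h1 : gyr 0 x y = y := by
    have h := add_gyroassoc 0 x y
    rw [Gyrogroup.zero_add, Gyrogroup.zero_add] at h
    exact (left_cancel h).symm
  rw [add_gyroassoc, Gyrogroup.neg_add_self, Gyrogroup.zero_add, h0, h1]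

theorem gyr_apply {G : Type*} [Gyrogroup G] (x y z : G) :
    gyr x y z = -(x + y) + (x + (y + z)) := by
  rw [add_gyroassoc x y z, neg_add_add]

theorem gyr_symm_apply {G : Type*} [Gyrogroup G] (x y z : G) :
    (gyr x y).symm z = -y + (-x + ((x + y) + z)) := by
  obtain ⟨w, rfl⟩ := (gyr x y).surjective z
  rw [AddEquiv.symm_apply_apply, ← add_gyroassoc, neg_add_add, neg_add_add]

/-- The agreement of the definition of a subgyrogroup with the one through the restricted
operation. -/
theorem isSubgyrogroup_iff {G : Type*} [Gyrogroup G] (H : Set G) :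
    IsSubgyrogroup H ↔ H.Nonempty ∧ (∀ x ∈ H, ∀ y ∈ H, x + y ∈ H) ∧
      (∀ x ∈ H, ∀ y ∈ H, Set.BijOn (gyr x y) H (gyr x y '' H)) ∧
      ∃ g : Gyrogroup H, ∀ x y : H, ((g.add x y : H) : G) = (x : G) + (y : G) := by
  constructor
  · intro hH
    refine ⟨hH.nonempty, hH.add_mem, fun x _ y _ => (gyr x y).injective.injOn.bijOn_image, ?_⟩
    have hg : ∀ x y z : H, gyr (x : G) y z ∈ H := fun x y z => by
      rw [gyr_apply]
      exact hH.add_mem _ (hH.neg_mem _ (hH.add_mem _ x.2 _ y.2)) _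
        (hH.add_mem _ x.2 _ (hH.add_mem _ y.2 _ z.2))
    have hs : ∀ x y z : H, (gyr (x : G) y).symm z ∈ H := fun x y z => by
      rw [gyr_symm_apply]
      exact hH.add_mem _ (hH.neg_mem _ y.2) _ (hH.add_mem _ (hH.neg_mem _ x.2) _
        (hH.add_mem _ (hH.add_mem _ x.2 _ y.2) _ z.2))
    let addH : Add H := ⟨fun x y => ⟨x + y, hH.add_mem _ x.2 _ y.2⟩⟩
    exact ⟨{ add := addH.add
             zero := ⟨0, hH.zero_mem⟩
             neg := fun x => ⟨-x, hH.neg_mem _ x.2⟩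
             gyr := fun x y =>
               { toFun := fun z => ⟨gyr (x : G) y z, hg x y z⟩
                 invFun := fun z => ⟨(gyr (x : G) y).symm z, hs x y z⟩
                 left_inv := fun z => Subtype.ext ((gyr (x : G) y).symm_apply_apply z)
                 right_inv := fun z => Subtype.ext ((gyr (x : G) y).apply_symm_apply z)
                 map_add' := fun z w => Subtype.ext (map_add (gyr (x : G) y) (z : G) w) }
             zero_add := fun x => Subtype.ext (Gyrogroup.zero_add (x : G))
             add_zero := fun x => Subtype.ext (Gyrogroup.add_zero (x : G))
             neg_add_self := fun x => Subtype.ext (Gyrogroup.neg_add_self (x : G))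
             add_neg_self := fun x => Subtype.ext (Gyrogroup.add_neg_self (x : G))
             add_gyroassoc := fun x y z => Subtype.ext (add_gyroassoc (x : G) y z)
             gyr_loop := fun x y => AddEquiv.ext fun z => Subtype.ext
               (congrArg (fun f : G ≃+ G => f z) (gyr_loop (x : G) y)) },
      fun x y => rfl⟩
  · rintro ⟨hne, hadd, -, g, hg⟩
    refine ⟨hne, hadd, fun x hx => ?_⟩
    have h0 : ((g.zero : H) : G) = 0 := by
      have h := congrArg (Subtype.val) (g.zero_add g.zero)
      have h2 : ((g.zero : H) : G) + ((g.zero : H) : G) = ((g.zero : H) : G) :=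
        (hg _ _).symm.trans h
      exact left_cancel (h2.trans (Gyrogroup.add_zero _).symm)
    have h1 := congrArg (Subtype.val) (g.add_neg_self ⟨x, hx⟩)
    have h2 : x + ((g.neg ⟨x, hx⟩ : H) : G) = 0 := ((hg _ _).symm.trans h1).trans h0
    rw [← eq_neg_of_add_eq_zero h2]
    exact (g.neg ⟨x, hx⟩).2

/-- The subgyrogroup `⟨S⟩` generated by a set `S`: the smallest subgyrogroup containing `S`. -/
def generated {G : Type*} [Gyrogroup G] (S : Set G) : Set G :=
  ⋂₀ {H : Set G | IsSubgyrogroup H ∧ S ⊆ H}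

end Gyrogroup

/-- A topological gyrogroup: `⊕` is jointly continuous and `⊖` is continuous. -/
class TopologicalGyrogroup (G : Type*) [TopologicalSpace G] [Gyrogroup G] : Prop
    extends ContinuousAdd G, ContinuousNeg G

/-- A suitable set for a topological gyrogroup. -/
structure IsSuitableSet {G : Type*} [TopologicalSpace G] [Gyrogroup G] (S : Set G) : Prop where
  /-- `S` is discrete in the subspace topology. -/
  discrete : DiscreteTopology S
  dense_generated : Dense (Gyrogroup.generated S)
  isClosed_union_zero : IsClosed (S ∪ {0})

/-!
It suffices to find a set `S` with `S \ W` finite for every neighbourhood `W` of `0` and with `⟨S⟩`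
dense (`Gyrogroup.isSuitableSet_of_converging`). Such a set is obtained by refining approximations
of it modulo congruences; the role that compact normal subgroups have for groups is taken by closed
congruences of `(G, ⊕)`. The classes of a congruence are the translates `x ⊕ N` of its kernel `N`,
the class of `0`, so that neither quotients nor invariance under gyroautomorphisms have to be
considered.

The gyrogroup `G` is locally compact and σ-compact. As the functions of `x, y, v, w` that express
that the translates of a set `N` are the classes of a congruence vanish at `v = w = 0`, the tube
lemma on the members of a compact exhaustion gives a sequence of compact neighbourhoods `V n`
of `0`, arbitrarily small, whose intersection is the kernel of a congruence
(`Gyrogroup.exists_isAdmissible`, `Gyrogroup.IsAdmissible.con`). Modulo this congruence `G` is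
metrizable, and the classical argument for metrizable groups applies: finite nets of the `V n`,
with successive approximation, give a set that converges to the kernel `⋂ n, V n` and, together with
it, generates any prescribed compact set up to closure
(`Gyrogroup.IsAdmissible.exists_converging_generators`).

A `Gyrogroup.Approximation` is a congruence with a family of its classes that converges to the
kernel and generates a dense subgyrogroup. If its kernel `N` contains `z ≠ 0`, it can be refined to
one whose kernel omits `z` (`Gyrogroup.Approximation.exists_refinement`): intersect the congruence
with one coming from an admissible sequence, replace each old class by a smaller class inside it
that lies in `V n` for `n` as large as possible, and add new classes inside `N` that generate `N`.
Chains have upper bounds by compactness of the kernels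
(`Gyrogroup.Approximation.exists_upper_bound`); density survives because the saturation of a closed
subgyrogroup under a congruence with compact kernel is again a closed subgyrogroup. By Zorn's lemma
there is an approximation with kernel `{0}`, and its classes are the points of `S`.
-/

open Topology Filter Pointwise

namespace Gyrogroup

/-! ### Elementary identities and subgyrogroups -/

section Algebra

variable {G : Type*} [Gyrogroup G]

theorem neg_neg_eq (x : G) : -(-x) = x :=
  (eq_neg_of_add_eq_zero (Gyrogroup.neg_add_self x)).symm

theorem add_neg_add (x y : G) : x + (-x + y) = y := by
  simpa only [neg_neg_eq] using neg_add_add (-x) y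

theorem isSubgyrogroup_generated (S : Set G) : IsSubgyrogroup (generated S) where
  nonempty := ⟨0, fun _ hH => hH.1.zero_mem⟩
  add_mem x hx y hy := fun H hH => hH.1.add_mem x (hx H hH) y (hy H hH)
  neg_mem x hx := fun H hH => hH.1.neg_mem x (hx H hH)

theorem subset_generated (S : Set G) : S ⊆ generated S := fun _ hx _ hH => hH.2 hx

theorem generated_subset {S H : Set G} (hH : IsSubgyrogroup H) (h : S ⊆ H) : generated S ⊆ H :=
  fun _ hx => hx H ⟨hH, h⟩

/-! ### Congruences -/

theorem con_neg (r : AddCon G) {x y : G} (h : r x y) : r (-x) (-y) := by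
  have h1 : r (x + -y) 0 := by
    simpa only [Gyrogroup.add_neg_self] using r.add h (r.refl (-y))
  have h2 := r.add (r.refl (-x)) h1
  rw [neg_add_add, Gyrogroup.add_zero] at h2
  exact r.symm h2

theorem con_iff_zero (r : AddCon G) {x y : G} : r x y ↔ r 0 (-x + y) := by
  constructor
  · intro h
    simpa only [Gyrogroup.neg_add_self] using r.add (r.refl (-x)) h
  · intro h
    simpa only [Gyrogroup.add_zero, add_neg_add] using r.add (r.refl x) h

/-- The kernel of a congruence: the congruence class of the identity. -/
def conKer (r : AddCon G) : Set G := {x | r 0 x}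

/-- The congruence class of an element. -/
def conClass (r : AddCon G) (x : G) : Set G := {y | r x y}

theorem isSubgyrogroup_conKer (r : AddCon G) : IsSubgyrogroup (conKer r) where
  nonempty := ⟨0, r.refl 0⟩
  add_mem x hx y hy := by
    have h := r.add hx hy
    rwa [Gyrogroup.add_zero] at h
  neg_mem x hx := by
    have h0 : (-0 : G) = 0 := (eq_neg_of_add_eq_zero (Gyrogroup.add_zero (0 : G))).symm
    have h := con_neg r hx
    rwa [h0] at h

theorem conClass_eq_preimage (r : AddCon G) (x : G) :
    conClass r x = (fun y => -x + y) ⁻¹' conKer r :=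
  Set.ext fun _ => con_iff_zero r

theorem conClass_eq_image (r : AddCon G) (x : G) :
    conClass r x = (fun y => x + y) '' conKer r := by
  ext y
  constructor
  · intro h
    exact ⟨-x + y, (con_iff_zero r).1 h, add_neg_add x y⟩
  · rintro ⟨n, hn, rfl⟩
    refine (con_iff_zero r).2 ?_
    rw [neg_add_add]
    exact hn

theorem conClass_zero (r : AddCon G) : conClass r 0 = conKer r := rfl

theorem conClass_eq_of_rel (r : AddCon G) {x y : G} (h : r x y) : conClass r x = conClass r y :=
  Set.ext fun _ => ⟨fun hz => r.trans (r.symm h) hz, fun hz => r.trans h hz⟩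

/-- A subgyrogroup containing the kernel of a congruence is a union of congruence classes. -/
theorem IsSubgyrogroup.mem_of_rel {H : Set G} (hH : IsSubgyrogroup H) {r : AddCon G}
    (hN : conKer r ⊆ H) {x y : G} (hx : x ∈ H) (h : r x y) : y ∈ H := by
  rw [← add_neg_add x y]
  exact hH.add_mem _ hx _ (hN ((con_iff_zero r).1 h))

/-- The saturation of a subgyrogroup under a congruence. -/
def saturation (r : AddCon G) (H : Set G) : Set G := {y | ∃ h ∈ H, r y h}

theorem isSubgyrogroup_saturation (r : AddCon G) {H : Set G} (hH : IsSubgyrogroup H) :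
    IsSubgyrogroup (saturation r H) where
  nonempty := hH.nonempty.imp fun x hx => ⟨x, hx, r.refl x⟩
  add_mem := by
    rintro x ⟨h, hh, hx⟩ y ⟨k, hk, hy⟩
    exact ⟨h + k, hH.add_mem _ hh _ hk, r.add hx hy⟩
  neg_mem := by
    rintro x ⟨h, hh, hx⟩
    exact ⟨-h, hH.neg_mem _ hh, con_neg r hx⟩

end Algebra

section Topological

variable {G : Type*} [TopologicalSpace G] [Gyrogroup G] [TopologicalGyrogroup G]

theorem isSubgyrogroup_closure {H : Set G} (hH : IsSubgyrogroup H) :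
    IsSubgyrogroup (closure H) where
  nonempty := hH.nonempty.closure
  add_mem _ hx _ hy := map_mem_closure₂ continuous_add hx hy hH.add_mem
  neg_mem _ hx := map_mem_closure continuous_neg hx hH.neg_mem

theorem isClosed_conClass {r : AddCon G} (hr : IsClosed (conKer r)) (x : G) :
    IsClosed (conClass r x) := by
  rw [conClass_eq_preimage]
  exact hr.preimage (continuous_const.add continuous_id)

theorem isCompact_conClass {r : AddCon G} (hr : IsCompact (conKer r)) (x : G) :
    IsCompact (conClass r x) := by
  rw [conClass_eq_image]
  exact hr.image (continuous_const.add continuous_id)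

theorem isClosed_saturation {r : AddCon G} (hr : IsCompact (conKer r)) {H : Set G}
    (hH : IsClosed H) : IsClosed (saturation r H) := by
  have heq : (saturation r H)ᶜ = {y | ∀ n ∈ conKer r, y + n ∈ Hᶜ} := by
    ext y
    constructor
    · intro hy n hn hyn
      exact hy ⟨y + n, hyn, by simpa only [Gyrogroup.add_zero] using r.add (r.refl y) hn⟩
    · rintro hy ⟨h, hh, hyh⟩
      refine hy (-y + h) ((con_iff_zero r).1 hyh) ?_
      rwa [add_neg_add]
  rw [← isOpen_compl_iff, heq, isOpen_iff_eventually]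
  intro y hy
  refine hr.eventually_forall_of_forall_eventually fun n hn => ?_
  exact (continuous_add.tendsto (y, n)).eventually (hH.isOpen_compl.mem_nhds (hy n hn))

/-! ### Compact exhaustions -/

theorem locallyCompactSpace_of_isOpen [T2Space G] {U : Set G} (hU : IsOpen U)
    (hne : U.Nonempty) (hc : IsCompact (closure U)) : LocallyCompactSpace G := by
  have : WeaklyLocallyCompactSpace G := ⟨fun x => by
    obtain ⟨u, hu⟩ := hne
    refine ⟨(fun z => x + (-u + z)) '' closure U, hc.image (by fun_prop), ?_⟩
    have hcont : Continuous fun y : G => u + (-x + y) := by fun_prop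
    have hx : U ∈ 𝓝 (u + (-x + x)) := by
      rw [Gyrogroup.neg_add_self, Gyrogroup.add_zero]
      exact hU.mem_nhds hu
    filter_upwards [hcont.continuousAt.preimage_mem_nhds hx] with y hy
    exact ⟨_, subset_closure hy, by simp only [neg_add_add, add_neg_add]⟩⟩
  infer_instance

/-- The finite stages of the generation of a subgyrogroup by a set. -/
def stage (C : Set G) : ℕ → Set G
  | 0 => C
  | n + 1 => stage C n ∪ ((stage C n + stage C n) ∪ (fun x => -x) '' stage C n)

theorem sigmaCompactSpace_of_generated {U C : Set G} (hne : C.Nonempty) (hC : IsCompact C)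
    (hUC : U ⊆ C) (hgen : generated U = Set.univ) : SigmaCompactSpace G := by
  have hcomp : ∀ n, IsCompact (stage C n) := fun n => by
    induction n with
    | zero => exact hC
    | succ n ih => exact ih.union ((ih.add ih).union (ih.image continuous_neg))
  have hmono : Monotone (stage C) := monotone_nat_of_le_succ fun n => Set.subset_union_left
  have hH : IsSubgyrogroup (⋃ n, stage C n) :=
    { nonempty := hne.mono (Set.subset_iUnion (stage C) 0)
      add_mem := fun x hx y hy => by
        obtain ⟨m, hm⟩ := Set.mem_iUnion.1 hx
        obtain ⟨n, hn⟩ := Set.mem_iUnion.1 hy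
        refine Set.mem_iUnion.2 ⟨max m n + 1, Or.inr (Or.inl ?_)⟩
        exact Set.add_mem_add (hmono (le_max_left m n) hm) (hmono (le_max_right m n) hn)
      neg_mem := fun x hx => by
        obtain ⟨m, hm⟩ := Set.mem_iUnion.1 hx
        refine Set.mem_iUnion.2 ⟨m + 1, Or.inr (Or.inr ?_)⟩
        exact Set.mem_image_of_mem _ hm }
  refine ⟨⟨stage C, hcomp, ?_⟩⟩
  refine Set.eq_univ_of_univ_subset (hgen ▸ generated_subset hH ?_)
  exact hUC.trans (Set.subset_iUnion (stage C) 0)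

end Topological

/-! ### Admissible sequences of neighbourhoods -/

section Admissible

variable {G : Type*} [TopologicalSpace G] [Gyrogroup G]

theorem exists_mem_exhaustion {X : Type*} [TopologicalSpace X] (K : CompactExhaustion X) (x : X) :
    ∃ m, ∀ n ≥ m, x ∈ K n := by
  obtain ⟨m, hm⟩ := K.exists_mem x
  exact ⟨m, fun n hn => K.subset hn hm⟩

/-- A decreasing sequence of compact neighbourhoods `V n` of the identity that is small relative
to the compact exhaustion `K`. The first two relations make "the translates of `⋂ n, V n`" a
congruence; the third one says that correcting `x + y` by an approximation of the exact correction
`-(x + y) + x` leads back close to `x`. -/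
structure IsAdmissible (K : CompactExhaustion G) (V : ℕ → Set G) : Prop where
  isCompact : ∀ n, IsCompact (V n)
  mem_nhds : ∀ n, V n ∈ 𝓝 0
  succ_subset : ∀ n, V (n + 1) ⊆ V n
  symm_mem : ∀ n, ∀ x ∈ K n, ∀ v ∈ V (n + 1), -(x + v) + x ∈ V n
  add_mem : ∀ n, ∀ x ∈ K n, ∀ y ∈ K n, ∀ v ∈ V (n + 1), ∀ w ∈ V (n + 1),
    -(x + y) + ((x + v) + (y + w)) ∈ V n
  correct_mem : ∀ n, ∀ x ∈ K n, ∀ y ∈ K n, ∀ v ∈ V (n + 1),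
    -x + ((x + y) + ((-(x + y) + x) + v)) ∈ V n

theorem eventually_mem_of_isCompact {K : Set G} (hK : IsCompact K) {V : Set G} (hV : V ∈ 𝓝 0)
    {f : G → G → G → G → G}
    (hf : Continuous fun p : (G × G) × (G × G) => f p.2.1 p.2.2 p.1.1 p.1.2)
    (h0 : ∀ x y, f x y 0 0 = 0) :
    ∃ W ∈ 𝓝 (0 : G), ∀ x ∈ K, ∀ y ∈ K, ∀ v ∈ W, ∀ w ∈ W, f x y v w ∈ V := by
  have h : ∀ᶠ q in 𝓝 ((0 : G), (0 : G)), ∀ p ∈ K ×ˢ K, f p.1 p.2 q.1 q.2 ∈ V := by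
    refine (hK.prod hK).eventually_forall_of_forall_eventually fun p _ => ?_
    refine (hf.tendsto ((0, 0), p)).eventually ?_
    rw [h0]
    exact hV
  obtain ⟨W₁, hW₁, W₂, hW₂, h⟩ := mem_nhds_prod_iff.1 h
  refine ⟨W₁ ∩ W₂, inter_mem hW₁ hW₂, fun x hx y hy v hv w hw => ?_⟩
  exact h (Set.mk_mem_prod hv.1 hw.2) (x, y) ⟨hx, hy⟩

namespace IsAdmissible

variable {K : CompactExhaustion G} {V : ℕ → Set G}

theorem anti (h : IsAdmissible K V) : Antitone V := antitone_nat_of_succ_le h.succ_subset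

theorem zero_mem (h : IsAdmissible K V) (n : ℕ) : (0 : G) ∈ V n := mem_of_mem_nhds (h.mem_nhds n)

theorem mem_of_eventually (h : IsAdmissible K V) {a : G} {m : ℕ} (ha : ∀ n ≥ m, a ∈ V n) (n : ℕ) :
    a ∈ V n :=
  h.anti (le_max_left n m) (ha _ (le_max_right n m))

/-- The congruence attached to an admissible sequence; its classes are the translates of
`⋂ n, V n`. -/
def con (h : IsAdmissible K V) : AddCon G where
  r x y := ∀ n, -x + y ∈ V n
  iseqv :=
    { refl := fun x n => by
        rw [Gyrogroup.neg_add_self]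
        exact h.zero_mem n
      symm := fun {x y} hxy => by
        obtain ⟨m, hm⟩ := exists_mem_exhaustion K x
        refine h.mem_of_eventually (m := m) fun n hn => ?_
        have := h.symm_mem n x (hm n hn) _ (hxy (n + 1))
        rwa [add_neg_add] at this
      trans := fun {x y z} hxy hyz => by
        obtain ⟨m, hm⟩ := exists_mem_exhaustion K x
        obtain ⟨m', hm'⟩ := exists_mem_exhaustion K 0
        refine h.mem_of_eventually (m := max m m') fun n hn => ?_
        have := h.add_mem n x (hm n (le_of_max_le_left hn)) 0 (hm' n (le_of_max_le_right hn))
          _ (hxy (n + 1)) _ (hyz (n + 1))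
        rwa [add_neg_add, Gyrogroup.zero_add, add_neg_add, Gyrogroup.add_zero] at this }
  add' := fun {x x' y y'} hx hy n => by
    obtain ⟨m, hm⟩ := exists_mem_exhaustion K x
    obtain ⟨m', hm'⟩ := exists_mem_exhaustion K y
    revert n
    refine h.mem_of_eventually (m := max m m') fun n hn => ?_
    have := h.add_mem n x (hm n (le_of_max_le_left hn)) y (hm' n (le_of_max_le_right hn))
      _ (hx (n + 1)) _ (hy (n + 1))
    rwa [add_neg_add, add_neg_add] at this

theorem conKer_con (h : IsAdmissible K V) : conKer h.con = ⋂ n, V n := by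
  have h0 : (-0 : G) = 0 := (eq_neg_of_add_eq_zero (Gyrogroup.add_zero (0 : G))).symm
  ext x
  change (∀ n, -0 + x ∈ V n) ↔ _
  rw [h0, Gyrogroup.zero_add, Set.mem_iInter]

end IsAdmissible

variable [TopologicalGyrogroup G]

theorem exists_isAdmissible [LocallyCompactSpace G] (K : CompactExhaustion G) {W : Set G}
    (hW : W ∈ 𝓝 0) : ∃ V : ℕ → Set G, IsAdmissible K V ∧ V 0 ⊆ W := by
  have step : ∀ (n : ℕ) (V : Set G), V ∈ 𝓝 (0 : G) →
      ∃ V' : Set G, (IsCompact V' ∧ V' ∈ 𝓝 (0 : G)) ∧ V' ⊆ V ∧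
      (∀ x ∈ K n, ∀ v ∈ V', -(x + v) + x ∈ V) ∧
      (∀ x ∈ K n, ∀ y ∈ K n, ∀ v ∈ V', ∀ w ∈ V', -(x + y) + ((x + v) + (y + w)) ∈ V) ∧
      (∀ x ∈ K n, ∀ y ∈ K n, ∀ v ∈ V', -x + ((x + y) + ((-(x + y) + x) + v)) ∈ V) := by
    intro n V hV
    obtain ⟨W₁, hW₁, h₁⟩ := eventually_mem_of_isCompact (K.isCompact n) hV
      (f := fun x _ v _ => -(x + v) + x) (by fun_prop)
      (fun x _ => by simp only [Gyrogroup.add_zero, Gyrogroup.neg_add_self])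
    obtain ⟨W₂, hW₂, h₂⟩ := eventually_mem_of_isCompact (K.isCompact n) hV
      (f := fun x y v w => -(x + y) + ((x + v) + (y + w))) (by fun_prop)
      (fun x _ => by simp only [Gyrogroup.add_zero, Gyrogroup.neg_add_self])
    obtain ⟨W₃, hW₃, h₃⟩ := eventually_mem_of_isCompact (K.isCompact n) hV
      (f := fun x y v _ => -x + ((x + y) + ((-(x + y) + x) + v))) (by fun_prop)
      (fun x _ => by simp only [Gyrogroup.add_zero, add_neg_add, Gyrogroup.neg_add_self])
    obtain ⟨V', hV', hsub, hc⟩ := local_compact_nhds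
      (inter_mem hV (inter_mem hW₁ (inter_mem hW₂ hW₃)))
    refine ⟨V', ⟨hc, hV'⟩, fun v hv => (hsub hv).1,
      fun x hx v hv => h₁ x hx x hx v (hsub hv).2.1 v (hsub hv).2.1,
      fun x hx y hy v hv w hw => h₂ x hx y hy v (hsub hv).2.2.1 w (hsub hw).2.2.1,
      fun x hx y hy v hv => h₃ x hx y hy v (hsub hv).2.2.2 v (hsub hv).2.2.2⟩
  choose next hnext using step
  obtain ⟨V₀, hV₀, hsub, hc⟩ := local_compact_nhds hW
  let V : ℕ → {V : Set G // IsCompact V ∧ V ∈ 𝓝 (0 : G)} := fun n =>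
    Nat.rec ⟨V₀, hc, hV₀⟩ (fun n V => ⟨next n V.1 V.2.2, (hnext n V.1 V.2.2).1⟩) n
  have hV := fun n => (hnext n (V n).1 (V n).2.2).2
  exact ⟨fun n => (V n).1, ⟨fun n => (V n).2.1, fun n => (V n).2.2, fun n => (hV n).1,
    fun n => (hV n).2.1, fun n => (hV n).2.2.1, fun n => (hV n).2.2.2⟩, hsub⟩

/-- Compact sets have finite nets, up to any prescribed neighbourhood of the identity. -/
theorem exists_finite_net {C W : Set G} (hC : IsCompact C) (hW : W ∈ 𝓝 (0 : G)) :
    ∃ F ⊆ C, F.Finite ∧ ∀ x ∈ C, ∃ f ∈ F, -x + f ∈ W := by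
  obtain ⟨t, ht, hcov⟩ := hC.elim_nhds_subcover (fun f => {x | -x + f ∈ W}) fun f _ => by
    have hcont : Continuous fun x : G => -x + f := by fun_prop
    refine hcont.continuousAt.preimage_mem_nhds ?_
    rwa [Gyrogroup.neg_add_self]
  refine ⟨t, ht, t.finite_toSet, fun x hx => ?_⟩
  obtain ⟨f, hf, hxf⟩ := Set.mem_iUnion₂.1 (hcov hx)
  exact ⟨f, hf, hxf⟩

namespace IsAdmissible

variable {K : CompactExhaustion G} {V : ℕ → Set G}

/-- Modulo the congruence of an admissible sequence, a compact subset of a closed subgyrogroup `M`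
lies in the closed subgyrogroup generated by a subset of `M` converging to the kernel. -/
theorem exists_converging_generators [T2Space G] (h : IsAdmissible K V) {M C : Set G}
    (hM : IsSubgyrogroup M) (hMc : IsClosed M) (hC : IsCompact C) (hCM : C ⊆ M) :
    ∃ S ⊆ M, (∀ n, (S \ V n).Finite) ∧ ∀ H : Set G, IsSubgyrogroup H → IsClosed H → S ⊆ H →
      (⋂ n, V n) ∩ M ⊆ H → C ⊆ H := by
  obtain ⟨a₀, ha₀⟩ := K.exists_superset_of_isCompact hC
  obtain ⟨b₀, hb₀⟩ := K.exists_superset_of_isCompact (h.isCompact 0)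
  -- From the index `k₀` on, `K n` contains both `C` and all the neighbourhoods `V m`.
  obtain ⟨k₀, hCK, hVK⟩ : ∃ k₀, (∀ n ≥ k₀, C ⊆ K n) ∧ ∀ n ≥ k₀, V 0 ⊆ K n :=
    ⟨max a₀ b₀, fun n hn => ha₀.trans (K.subset (le_of_max_le_left hn)),
      fun n hn => hb₀.trans (K.subset (le_of_max_le_right hn))⟩
  obtain ⟨E, hEC, hEfin, hE⟩ := exists_finite_net hC (h.mem_nhds (k₀ + 1))
  choose F hFsub hFfin hF using fun n =>
    exists_finite_net ((h.isCompact n).inter_right hMc) (h.mem_nhds (n + 3))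
  refine ⟨E ∪ ⋃ n, F n, ?_, fun m => ?_, fun H hH hHc hSH hNH x hx => ?_⟩
  · exact Set.union_subset (hEC.trans hCM)
      (Set.iUnion_subset fun n => (hFsub n).trans Set.inter_subset_right)
  · refine (hEfin.union ((Set.finite_lt_nat m).biUnion fun n _ => hFfin n)).subset ?_
    rintro s ⟨hs | hs, hsm⟩
    · exact Or.inl hs
    · obtain ⟨n, hn⟩ := Set.mem_iUnion.1 hs
      refine Or.inr (Set.mem_biUnion (x := n) ?_ hn)
      by_contra hmn
      exact hsm (h.anti (not_lt.1 hmn) (hFsub n hn).1)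
  · have hxM := hCM hx
    -- Successive approximation of `x` inside `H`: if `y` is close to `x`, adding to `y` a member
    -- of the net close to the exact correction `-y + x` gives a better approximation.
    have key : ∀ k ≥ k₀, ∃ y ∈ H ∩ M, -x + y ∈ V (k + 1) := by
      intro k hk
      induction k, hk using Nat.le_induction with
      | base =>
        obtain ⟨f, hf, hxf⟩ := hE x hx
        exact ⟨f, ⟨hSH (Or.inl hf), hCM (hEC hf)⟩, hxf⟩
      | succ k hk ih =>
        obtain ⟨y, ⟨hyH, hyM⟩, hy⟩ := ih
        have hyx : -y + x ∈ V k ∩ M := by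
          refine ⟨?_, hM.add_mem _ (hM.neg_mem _ hyM) _ hxM⟩
          have := h.symm_mem k x (hCK k hk hx) _ hy
          rwa [add_neg_add] at this
        obtain ⟨f, hf, hyf⟩ := hF k _ hyx
        refine ⟨y + f, ⟨hH.add_mem _ hyH _ (hSH (Or.inr (Set.mem_iUnion.2 ⟨k, hf⟩))),
          hM.add_mem _ hyM _ (hFsub k hf).2⟩, ?_⟩
        have hk2 : k + 1 + 1 ≥ k₀ := by omega
        have := h.correct_mem (k + 1 + 1) x (hCK _ hk2 hx) (-x + y)
          (hVK _ hk2 (h.anti (Nat.zero_le _) hy)) _ hyf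
        rwa [add_neg_add, add_neg_add] at this
    have hmeet : (⋂ n, {w | x + w ∈ H} ∩ (V (k₀ + n + 1) ∩ M)).Nonempty := by
      have hcl : IsClosed {w | x + w ∈ H} := hHc.preimage (continuous_const.add continuous_id)
      refine IsCompact.nonempty_iInter_of_sequence_nonempty_isCompact_isClosed _ (fun n => ?_)
        (fun n => ?_) (((h.isCompact _).inter_right hMc).inter_left hcl)
        (fun n => hcl.inter ((h.isCompact _).isClosed.inter hMc))
      · exact Set.inter_subset_inter_right _
          (Set.inter_subset_inter_left _ (h.anti (by omega)))
      · obtain ⟨y, ⟨hyH, hyM⟩, hy⟩ := key (k₀ + n) (by omega)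
        refine ⟨-x + y, ?_, hy, hM.add_mem _ (hM.neg_mem _ hxM) _ hyM⟩
        change x + (-x + y) ∈ H
        rwa [add_neg_add]
    obtain ⟨w, hw⟩ := hmeet
    have hw := fun n => Set.mem_iInter.1 hw n
    -- `x + w` and `x` are congruent, and their difference lies in `M` and in every `V n`.
    have hrel : h.con (x + w) x := by
      refine h.con.symm ((con_iff_zero _).2 ?_)
      rw [neg_add_add]
      change w ∈ conKer h.con
      rw [h.conKer_con, Set.mem_iInter]
      exact h.mem_of_eventually (m := k₀ + 1) fun n hn => by
        have := (hw (n - (k₀ + 1))).2.1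
        rwa [show k₀ + (n - (k₀ + 1)) + 1 = n by omega] at this
    have hdiff : -(x + w) + x ∈ (⋂ n, V n) ∩ M := by
      refine ⟨?_, hM.add_mem _ (hM.neg_mem _ (hM.add_mem _ hxM _ (hw 0).2.2)) _ hxM⟩
      rw [← h.conKer_con]
      exact (con_iff_zero _).1 hrel
    rw [← add_neg_add (x + w) x]
    exact hH.add_mem _ (hw 0).1 _ (hNH hdiff)

end IsAdmissible

end Admissible

/-! ### Approximate suitable sets -/

section Approximation

/-- A suitable set known up to a congruence `con`: a family of congruence classes that converges
to the kernel of `con` and generates a dense subgyrogroup. The index set `AddCon G × G` is large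
enough to leave room for new members at every refinement: the indices `(s, g)` with `s ≤ con` are
those not yet used, and carry the trivial class. -/
structure Approximation (G : Type*) [TopologicalSpace G] [Gyrogroup G] where
  /-- The congruence up to which the members of the family are determined. -/
  con : AddCon G
  /-- The family of congruence classes. -/
  cls : AddCon G × G → Set G
  isClosed_ker : IsClosed (conKer con)
  exists_eq_conClass : ∀ d, ∃ x, cls d = conClass con x
  /-- The family converges to the kernel. -/
  finite_not_subset : ∀ W, IsOpen W → conKer con ⊆ W → {d | ¬ cls d ⊆ W}.Finite
  /-- The classes generate a dense subgyrogroup. -/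
  eq_univ_of_subset : ∀ H, IsSubgyrogroup H → IsClosed H → (∀ d, cls d ⊆ H) → H = Set.univ
  /-- Unused indices carry the trivial class. -/
  cls_of_le : ∀ s ≤ con, ∀ g, cls (s, g) = conKer con

namespace Approximation

variable {G : Type*} [TopologicalSpace G] [Gyrogroup G]

/-- `a.IsRefinedBy b` if `b` has a finer congruence and shrinks every class of `a`. -/
def IsRefinedBy (a b : Approximation G) : Prop := b.con ≤ a.con ∧ ∀ d, b.cls d ⊆ a.cls d

theorem IsRefinedBy.refl (a : Approximation G) : a.IsRefinedBy a := ⟨le_rfl, fun _ => subset_rfl⟩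

theorem IsRefinedBy.trans {a b c : Approximation G} (hab : a.IsRefinedBy b)
    (hbc : b.IsRefinedBy c) : a.IsRefinedBy c :=
  ⟨hbc.1.trans hab.1, fun d => (hbc.2 d).trans (hab.2 d)⟩

theorem nonempty_cls (a : Approximation G) (d : AddCon G × G) : (a.cls d).Nonempty := by
  obtain ⟨x, hx⟩ := a.exists_eq_conClass d
  exact ⟨x, hx ▸ a.con.refl x⟩

theorem cls_eq_of_mem (a : Approximation G) {d : AddCon G × G} {x : G} (hx : x ∈ a.cls d) :
    a.cls d = conClass a.con x := by
  obtain ⟨y, hy⟩ := a.exists_eq_conClass d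
  rw [hy] at hx ⊢
  exact conClass_eq_of_rel _ hx

/-- The trivial approximation, with the whole gyrogroup as the only congruence class. -/
def trivial (G : Type*) [TopologicalSpace G] [Gyrogroup G] : Approximation G where
  con := ⊤
  cls _ := Set.univ
  isClosed_ker := by
    have : conKer (⊤ : AddCon G) = Set.univ := Set.eq_univ_of_forall fun _ => True.intro
    rw [this]
    exact isClosed_univ
  exists_eq_conClass _ := ⟨0, (Set.eq_univ_of_forall fun _ => True.intro).symm⟩
  finite_not_subset W _ hW := by
    have : {d : AddCon G × G | ¬ Set.univ ⊆ W} = ∅ :=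
      Set.eq_empty_of_forall_notMem fun _ hd => hd fun x _ => hW (show x ∈ conKer ⊤ from True.intro)
    rw [this]
    exact Set.finite_empty
  eq_univ_of_subset H _ _ h := Set.eq_univ_of_univ_subset (h (⊤, 0))
  cls_of_le _ _ _ := (Set.eq_univ_of_forall fun _ => True.intro).symm

variable [TopologicalGyrogroup G]

theorem isClosed_cls (a : Approximation G) (d : AddCon G × G) : IsClosed (a.cls d) := by
  obtain ⟨x, hx⟩ := a.exists_eq_conClass d
  exact hx ▸ isClosed_conClass a.isClosed_ker x

theorem isCompact_cls (a : Approximation G) (ha : IsCompact (conKer a.con)) (d : AddCon G × G) :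
    IsCompact (a.cls d) := by
  obtain ⟨x, hx⟩ := a.exists_eq_conClass d
  exact hx ▸ isCompact_conClass ha x

/-- The classes of an approximation can be lifted to points that lie in the members of an
admissible sequence whenever the classes meet them. -/
theorem exists_lift [T2Space G] (a : Approximation G) {K : CompactExhaustion G} {V : ℕ → Set G}
    (h : IsAdmissible K V) (d : AddCon G × G) :
    ∃ x ∈ a.cls d, (∀ n, (a.cls d ∩ V n).Nonempty → x ∈ V n) ∧ (0 ∈ a.cls d → x = 0) := by
  classical
  by_cases h0 : 0 ∈ a.cls d
  · exact ⟨0, h0, fun n _ => h.zero_mem n, fun _ => rfl⟩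
  by_cases hall : ∀ n, (a.cls d ∩ V n).Nonempty
  · obtain ⟨x, hx⟩ := IsCompact.nonempty_iInter_of_sequence_nonempty_isCompact_isClosed
      (fun n => a.cls d ∩ V n) (fun n => Set.inter_subset_inter_right _ (h.succ_subset n)) hall
      ((h.isCompact 0).inter_left (a.isClosed_cls d))
      (fun n => (a.isClosed_cls d).inter (h.isCompact n).isClosed)
    rw [Set.mem_iInter] at hx
    exact ⟨x, (hx 0).1, fun n _ => (hx n).2, fun h' => absurd h' h0⟩
  · push Not at hall
    -- `m` is the first index at which the class misses `V m`; the lift is taken just before it.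
    let m := Nat.find hall
    have hm : a.cls d ∩ V m = ∅ := Nat.find_spec hall
    have hlt : ∀ n, (a.cls d ∩ V n).Nonempty → n < m := by
      rintro n ⟨y, hy, hyn⟩
      by_contra hn
      exact Set.eq_empty_iff_forall_notMem.1 hm y ⟨hy, h.anti (not_lt.1 hn) hyn⟩
    rcases Nat.eq_zero_or_pos m with hm0 | hpos
    · obtain ⟨x, hx⟩ := a.nonempty_cls d
      exact ⟨x, hx, fun n hn => absurd (hlt n hn) (by omega), fun h' => absurd h' h0⟩
    · have : (a.cls d ∩ V (m - 1)).Nonempty := by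
        rw [Set.nonempty_iff_ne_empty]
        exact Nat.find_min hall (Nat.sub_lt hpos one_pos)
      obtain ⟨x, hx, hxm⟩ := this
      exact ⟨x, hx, fun n hn => h.anti (Nat.le_sub_one_of_lt (hlt n hn)) hxm,
        fun h' => absurd h' h0⟩

/-- Almost all classes of an approximation meet a given member of an admissible sequence. -/
theorem finite_not_meeting (a : Approximation G) {K : CompactExhaustion G} {V : ℕ → Set G}
    (h : IsAdmissible K V) (n : ℕ) : {d | ¬ (a.cls d ∩ V n).Nonempty}.Finite := by
  -- the open set of points that are congruent to an interior point of `V n`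
  have hopen : IsOpen {y | ∃ k ∈ conKer a.con, y + k ∈ interior (V n)} := by
    have : {y | ∃ k ∈ conKer a.con, y + k ∈ interior (V n)} =
        ⋃ k ∈ conKer a.con, (fun y => y + k) ⁻¹' interior (V n) := by
      ext y
      simp only [Set.mem_ofPred_eq, Set.mem_iUnion, Set.mem_preimage, exists_prop]
    rw [this]
    exact isOpen_biUnion fun k _ => isOpen_interior.preimage (by fun_prop)
  refine (a.finite_not_subset _ hopen fun y hy => ?_).subset fun d hd hsub => hd ?_
  · refine ⟨-y, (isSubgyrogroup_conKer _).neg_mem _ hy, ?_⟩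
    rw [Gyrogroup.add_neg_self]
    exact mem_interior_iff_mem_nhds.2 (h.mem_nhds n)
  · obtain ⟨y, hy⟩ := a.nonempty_cls d
    obtain ⟨k, hk, hyk⟩ := hsub hy
    refine ⟨y + k, ?_, interior_subset hyk⟩
    rw [a.cls_eq_of_mem hy]
    change a.con y (y + k)
    simpa only [Gyrogroup.add_zero] using a.con.add (a.con.refl y) hk

/-- An approximation whose kernel is generated by a compact set can be refined so that the kernel
becomes compact and misses a given point. -/
theorem exists_refinement [T2Space G] [LocallyCompactSpace G] (K : CompactExhaustion G)
    (a : Approximation G) {C : Set G} (hC : IsCompact C) (hCa : C ⊆ conKer a.con)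
    (hgen : ∀ H, IsSubgyrogroup H → IsClosed H → C ⊆ H → conKer a.con ⊆ H)
    {z : G} (hz : z ∈ conKer a.con) (hz0 : z ≠ 0) :
    ∃ b : Approximation G, IsCompact (conKer b.con) ∧ a.IsRefinedBy b ∧ z ∉ conKer b.con := by
  classical
  obtain ⟨V, hV, hVz⟩ := exists_isAdmissible K (isOpen_compl_singleton.mem_nhds hz0.symm)
  obtain ⟨S, hSa, hSfin, hS⟩ := hV.exists_converging_generators
    (isSubgyrogroup_conKer a.con) a.isClosed_ker hC hCa
  choose x hxa hxV hx0 using a.exists_lift hV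
  set r : AddCon G := a.con ⊓ hV.con
  have hrel : ∀ {y w}, r y w ↔ a.con y w ∧ hV.con y w := AddCon.inf_iff_and
  have hker : conKer r = (⋂ n, V n) ∩ conKer a.con := by
    rw [← hV.conKer_con]
    ext y
    exact hrel.trans and_comm
  have hzr : z ∉ conKer r := fun hzr => by
    rw [hker] at hzr
    exact hVz (Set.mem_iInter.1 hzr.1 0) rfl
  have hra : ¬ a.con ≤ r := fun hle => hzr (hle hz)
  have hcomp : IsCompact (conKer r) := by
    rw [hker, ← Set.inter_eq_self_of_subset_left (Set.iInter_subset V 0), Set.inter_comm (⋂ n, V n),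
      Set.inter_assoc]
    exact (hV.isCompact 0).inter_right
      ((isClosed_iInter fun n => (hV.isCompact n).isClosed).inter a.isClosed_ker)
  -- the lifts of the old classes, and the points of `S` at the indices freed by passing to `r`
  let p : AddCon G × G → G := fun d => if d.1 = a.con ∧ d.2 ∈ S then d.2 else x d
  have hpa : ∀ d, p d ∈ a.cls d := fun d => by
    by_cases hd : d.1 = a.con ∧ d.2 ∈ S
    · simp only [p, if_pos hd]
      rw [← Prod.mk.eta (p := d), a.cls_of_le d.1 hd.1.le]
      exact hSa hd.2
    · simp only [p, if_neg hd]
      exact hxa d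
  have hpV : ∀ n, {d | p d ∉ V n}.Finite := fun n => by
    refine (((hSfin n).image (Prod.mk a.con)).union (a.finite_not_meeting hV n)).subset
      fun d hd => ?_
    by_cases hdS : d.1 = a.con ∧ d.2 ∈ S
    · simp only [p, Set.mem_ofPred_eq, if_pos hdS] at hd
      exact Or.inl ⟨d.2, ⟨hdS.2, hd⟩, Prod.ext hdS.1.symm rfl⟩
    · simp only [p, Set.mem_ofPred_eq, if_neg hdS] at hd
      exact Or.inr fun hne => hd (hxV d n hne)
  have hsub : ∀ d, conClass r (p d) ⊆ a.cls d := fun d y hy => by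
    rw [a.cls_eq_of_mem (hpa d)]
    exact (hrel.1 hy).1
  refine ⟨⟨r, fun d => conClass r (p d), hcomp.isClosed, fun d => ⟨p d, rfl⟩, ?_, ?_, ?_⟩,
    hcomp, ⟨inf_le_left, hsub⟩, hzr⟩
  · intro W hW hWr
    -- `W` contains the intersection of `V n` with a neighbourhood of the kernel of `a.con`.
    obtain ⟨n, hn⟩ : ∃ n, V n ∩ conKer a.con ⊆ W := by
      refine exists_subset_nhds_of_isCompact (V := fun n => V n ∩ conKer a.con) ?_
        (fun n => (hV.isCompact n).inter_right a.isClosed_ker) fun y hy => hW.mem_nhds (hWr ?_)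
      · exact (show Antitone fun n => V n ∩ conKer a.con from fun m n hmn =>
          Set.inter_subset_inter_left _ (hV.anti hmn)).directed_ge
      · rw [hker, Set.iInter_inter]
        exact hy
    have hO : IsOpen (V n \ W)ᶜ := by
      rw [isOpen_compl_iff]
      exact (hV.isCompact n).isClosed.sdiff hW
    obtain ⟨m, hm⟩ := exists_mem_exhaustion K 0
    refine ((a.finite_not_subset _ hO fun y hy hyn => hyn.2 (hn ⟨hyn.1, hy⟩)).union
      (hpV (max n m + 1))).subset fun d hd => ?_
    by_contra hd'
    rw [Set.mem_union, not_or] at hd'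
    simp only [Set.mem_ofPred_eq, not_not] at hd'
    refine hd fun y hy => ?_
    by_contra hyW
    refine hd'.1 (hsub d hy) ⟨hV.anti (le_max_left n m) ?_, hyW⟩
    have h0 := hm (max n m) (le_max_right n m)
    have := hV.add_mem _ 0 h0 0 h0 _ hd'.2 _ ((hrel.1 hy).2 (max n m + 1))
    simpa only [Gyrogroup.zero_add, Gyrogroup.add_zero, add_neg_add, Gyrogroup.neg_add_self,
      neg_add_add, (eq_neg_of_add_eq_zero (Gyrogroup.add_zero (0 : G))).symm] using this
  · intro H hH hHc hHd
    have h0 : conKer r ⊆ H := by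
      have hxz : p (⊥, 0) = 0 := by
        by_cases hd : (⊥ : AddCon G) = a.con ∧ (0 : G) ∈ S
        · exact if_pos hd
        · refine (if_neg hd).trans (hx0 _ ?_)
          rw [a.cls_of_le ⊥ bot_le]
          exact a.con.refl 0
      have := hHd (⊥, 0)
      rwa [hxz] at this
    have hSH : S ⊆ H := fun s hs => by
      have hps : p (a.con, s) = s := if_pos ⟨rfl, hs⟩
      have := hHd (a.con, s) (r.refl _)
      rwa [hps] at this
    have hN : conKer a.con ⊆ H := hgen H hH hHc (hS H hH hHc hSH (hker ▸ h0))
    refine a.eq_univ_of_subset H hH hHc fun d y hy => ?_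
    rw [a.cls_eq_of_mem (hpa d)] at hy
    exact hH.mem_of_rel hN (hHd d (r.refl _)) hy
  · intro s hs g
    have hne : ¬ (s = a.con ∧ g ∈ S) := fun h => hra (h.1 ▸ hs)
    have hpz : p (s, g) = 0 := by
      refine (if_neg hne).trans (hx0 _ ?_)
      rw [a.cls_of_le s (hs.trans inf_le_left)]
      exact a.con.refl 0
    change conClass r (p (s, g)) = conKer r
    rw [hpz, conClass_zero]

/-- A chain of approximations with compact kernels has an upper bound: the infimum of the
congruences, with the intersections of the classes. -/
theorem exists_upper_bound [T2Space G] {c : Set (Approximation G)} (hne : c.Nonempty)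
    (hchain : IsChain IsRefinedBy c) (hc : ∀ a ∈ c, IsCompact (conKer a.con)) :
    ∃ b : Approximation G, IsCompact (conKer b.con) ∧ ∀ a ∈ c, a.IsRefinedBy b := by
  have : Nonempty c := hne.to_subtype
  set r : AddCon G := sInf (con '' c)
  have hrel : ∀ {y w}, r y w ↔ ∀ a : c, a.1.con y w := fun {y w} => by
    constructor
    · intro h a
      exact h a.1.con ⟨a.1, a.2, rfl⟩
    · rintro h _ ⟨a, ha, rfl⟩
      exact h ⟨a, ha⟩
  have hdir : ∀ g : Approximation G → Set G, (∀ a b, a.IsRefinedBy b → g b ⊆ g a) →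
      Directed (· ⊇ ·) fun a : c => g a.1 := by
    intro g hg a b
    by_cases hab : a = b
    · exact ⟨a, subset_rfl, hab ▸ subset_rfl⟩
    rcases hchain a.2 b.2 fun h => hab (Subtype.ext h) with h | h
    · exact ⟨b, hg _ _ h, subset_rfl⟩
    · exact ⟨a, subset_rfl, hg _ _ h⟩
  have hclass : ∀ x, conClass r x = ⋂ a : c, conClass a.1.con x := fun x => by
    ext y
    rw [Set.mem_iInter]
    exact hrel
  have hker : conKer r = ⋂ a : c, conKer a.1.con := hclass 0
  have hcl : IsClosed (conKer r) := hker ▸ isClosed_iInter fun a => a.1.isClosed_ker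
  have hcomp : IsCompact (conKer r) := by
    obtain ⟨a⟩ := this
    exact (hc a.1 a.2).of_isClosed_subset hcl (hker ▸ Set.iInter_subset _ a)
  have hpt : ∀ d, ∃ x, ∀ a : c, x ∈ a.1.cls d := fun d => by
    obtain ⟨x, hx⟩ := IsCompact.nonempty_iInter_of_directed_nonempty_isCompact_isClosed
      (fun a : c => a.1.cls d)
      (hdir (fun a : Approximation G => a.cls d) fun a b hab => hab.2 d)
      (fun a => a.1.nonempty_cls d) (fun a => a.1.isCompact_cls (hc _ a.2) d)
      (fun a => a.1.isClosed_cls d)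
    exact ⟨x, Set.mem_iInter.1 hx⟩
  choose x hx using hpt
  have hcls : ∀ d, ⋂ a : c, a.1.cls d = conClass r (x d) := fun d => by
    rw [hclass]
    exact Set.iInter_congr fun a => a.1.cls_eq_of_mem (hx d a)
  refine ⟨⟨r, fun d => ⋂ a : c, a.1.cls d, hcl, fun d => ⟨x d, hcls d⟩, ?_, ?_, ?_⟩, hcomp,
    fun a ha => ⟨fun _ _ h => hrel.1 h ⟨a, ha⟩, fun d => Set.iInter_subset _ (⟨a, ha⟩ : c)⟩⟩
  · intro W hW hWr
    obtain ⟨a, ha⟩ := exists_subset_nhds_of_isCompact (V := fun a : c => conKer a.1.con)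
      (hdir (fun a : Approximation G => conKer a.con) fun a b hab y hy => hab.1 hy)
      (fun a => hc _ a.2) (U := W) fun y hy => hW.mem_nhds (hWr (hker ▸ hy))
    exact (a.1.finite_not_subset W hW ha).subset fun d hd hsub =>
      hd ((Set.iInter_subset _ a).trans hsub)
  · intro H hH hHc hHd
    have hN : conKer r ⊆ H := by
      have := hHd (⊥, 0)
      rwa [Set.iInter_congr fun a : c => a.1.cls_of_le ⊥ bot_le 0, ← hker] at this
    -- The saturation of `H` under each congruence of the chain is everything.
    have hsat : ∀ a : c, saturation a.1.con H = Set.univ := fun a => by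
      refine a.1.eq_univ_of_subset _ (isSubgyrogroup_saturation _ hH)
        (isClosed_saturation (hc _ a.2) hHc) fun d y hy => ?_
      have hxd := hHd d (Set.mem_iInter.2 (hx d))
      rw [a.1.cls_eq_of_mem (hx d a)] at hy
      exact ⟨x d, hxd, a.1.con.symm hy⟩
    refine Set.eq_univ_of_forall fun y => ?_
    obtain ⟨w, hw⟩ := IsCompact.nonempty_iInter_of_directed_nonempty_isCompact_isClosed
      (fun a : c => conClass a.1.con y ∩ H)
      (hdir (fun a : Approximation G => conClass a.con y ∩ H)
        fun a b hab w hw => ⟨hab.1 hw.1, hw.2⟩)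
      (fun a => by
        obtain ⟨h, hh, hyh⟩ := (hsat a).symm ▸ Set.mem_univ y
        exact ⟨h, hyh, hh⟩)
      (fun a => (isCompact_conClass (hc _ a.2) y).inter_right hHc)
      (fun a => (isClosed_conClass a.1.isClosed_ker y).inter hHc)
    rw [Set.mem_iInter] at hw
    have hyw : r y w := hrel.2 fun a => (hw a).1
    obtain ⟨a⟩ := this
    exact hH.mem_of_rel hN (hw a).2 (r.symm hyw)
  · intro s hs g
    rw [hker]
    exact Set.iInter_congr fun a => a.1.cls_of_le s (hs.trans fun _ _ h => hrel.1 h a) g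

/-- In a topological gyrogroup generated by a compact set there is an approximation whose
congruence is the equality. -/
theorem exists_conKer_eq_zero [T2Space G] [LocallyCompactSpace G] [SigmaCompactSpace G] {C : Set G}
    (hC : IsCompact C) (hgen : generated C = Set.univ) :
    ∃ a : Approximation G, conKer a.con = {0} := by
  let K := CompactExhaustion.choice G
  have hstart : Nonempty {a : Approximation G // IsCompact (conKer a.con)} := by
    by_cases hz : ∃ z : G, z ≠ 0
    · obtain ⟨z, hz⟩ := hz
      obtain ⟨b, hb, -⟩ := (trivial G).exists_refinement K hC (fun _ _ => True.intro)
        (fun H hH _ hCH y _ => generated_subset hH hCH (hgen ▸ Set.mem_univ y))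
        (z := z) True.intro hz
      exact ⟨⟨b, hb⟩⟩
    · push Not at hz
      have : Subsingleton G := ⟨fun x y => (hz x).trans (hz y).symm⟩
      exact ⟨⟨trivial G, Set.subsingleton_of_subsingleton.isCompact⟩⟩
  obtain ⟨⟨a, ha⟩, hmax⟩ := exists_maximal_of_nonempty_chains_bounded
    (α := {a : Approximation G // IsCompact (conKer a.con)})
    (r := fun a b => a.1.IsRefinedBy b.1) (fun c hchain hne => by
      obtain ⟨b, hb, hub⟩ := exists_upper_bound (c := Subtype.val '' c) (hne.image _)
        (by
          rintro _ ⟨a, ha, rfl⟩ _ ⟨b, hb, rfl⟩ hab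
          exact hchain ha hb fun h => hab (h ▸ rfl))
        (by
          rintro _ ⟨a, -, rfl⟩
          exact a.2)
      exact ⟨⟨b, hb⟩, fun a ha => hub a.1 ⟨a, ha, rfl⟩⟩)
    fun hab hbc => hab.trans hbc
  refine ⟨a, Set.Subset.antisymm (fun z hz => ?_) (Set.singleton_subset_iff.2 (a.con.refl 0))⟩
  by_contra hz0
  obtain ⟨b, hb, hab, hzb⟩ := a.exists_refinement K ha subset_rfl (fun _ _ _ h => h) hz hz0
  exact hzb ((hmax ⟨b, hb⟩ hab).1 hz)

end Approximation

end Approximation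

/-! ### Suitable sets -/

section Suitable

variable {G : Type*} [TopologicalSpace G] [T2Space G] [Gyrogroup G]

/-- A set that converges to the identity and generates a dense subgyrogroup is suitable once the
identity is removed. -/
theorem isSuitableSet_of_converging {S : Set G}
    (hfin : ∀ W, IsOpen W → (0 : G) ∈ W → (S \ W).Finite) (hdense : Dense (generated S)) :
    IsSuitableSet (S \ {0}) where
  discrete := by
    rw [discreteTopology_subtype_iff]
    rintro x ⟨-, hx0⟩
    obtain ⟨A, B, hA, hB, hxA, h0B, hAB⟩ := t2_separation hx0
    -- Only finitely many points of the set lie in `A`.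
    have hfinA : (((S \ {0}) ∩ A) \ {x}).Finite := (hfin B hB h0B).subset fun y hy =>
      ⟨hy.1.1.1, fun hyB => Set.disjoint_left.1 hAB hy.1.2 hyB⟩
    rw [← disjoint_iff, Filter.disjoint_principal_right, mem_nhdsWithin]
    refine ⟨A ∩ (((S \ {0}) ∩ A) \ {x})ᶜ, hA.inter hfinA.isClosed.isOpen_compl,
      ⟨hxA, fun h => h.2 rfl⟩, ?_⟩
    rintro y ⟨⟨hyA, hy⟩, hyx⟩ hyS
    exact hy ⟨⟨hyS, hyA⟩, hyx⟩
  dense_generated := by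
    refine hdense.mono (generated_subset (isSubgyrogroup_generated _) fun s hs => ?_)
    by_cases h0 : s = 0
    · exact h0.symm ▸ (isSubgyrogroup_generated _).zero_mem
    · exact subset_generated _ ⟨hs, h0⟩
  isClosed_union_zero := by
    rw [← isOpen_compl_iff, isOpen_iff_mem_nhds]
    intro x hx
    have hx0 : x ≠ 0 := fun h => hx (Or.inr h)
    obtain ⟨A, B, hA, hB, hxA, h0B, hAB⟩ := t2_separation hx0
    filter_upwards [hA.mem_nhds hxA, isOpen_compl_singleton.mem_nhds hx0,
      (hfin B hB h0B).isClosed.isOpen_compl.mem_nhds fun h => hx (Or.inl ⟨h.1, hx0⟩)]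
      with y hyA hy0 hyB hy
    rcases hy with hy | hy
    · exact hyB ⟨hy.1, fun h => Set.disjoint_left.1 hAB hyA h⟩
    · exact hy0 hy

theorem exists_isSuitableSet_of_approximation [TopologicalGyrogroup G] (a : Approximation G)
    (ha : conKer a.con = {0}) : ∃ S : Set G, IsSuitableSet S := by
  choose x hx using a.exists_eq_conClass
  have hsub : ∀ d, a.cls d ⊆ {x d} := fun d y hy => by
    rw [hx d, conClass_eq_image, ha, Set.image_singleton, Gyrogroup.add_zero] at hy
    exact hy
  have hmem : ∀ d, x d ∈ a.cls d := fun d => by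
    rw [hx d]
    exact a.con.refl _
  refine ⟨_, isSuitableSet_of_converging (S := Set.range x) (fun W hW h0 => ?_) ?_⟩
  · refine ((a.finite_not_subset W hW (ha ▸ Set.singleton_subset_iff.2 h0)).image x).subset ?_
    rintro _ ⟨⟨d, rfl⟩, hd⟩
    exact ⟨d, fun h => hd (h (hmem d)), rfl⟩
  · rw [dense_iff_closure_eq]
    refine a.eq_univ_of_subset _ (isSubgyrogroup_closure (isSubgyrogroup_generated _))
      isClosed_closure fun d => (hsub d).trans (Set.singleton_subset_iff.2 ?_)
    exact subset_closure (subset_generated _ ⟨d, rfl⟩)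

end Suitable

end Gyrogroup

theorem theorem20 {G : Type*} [TopologicalSpace G] [T2Space G] [Gyrogroup G]
    [TopologicalGyrogroup G]
    (hG : ∃ U : Set G, IsOpen U ∧ IsCompact (closure U) ∧ Gyrogroup.generated U = Set.univ) :
    ∃ S : Set G, IsSuitableSet S := by
  obtain ⟨U, hU, hc, hgen⟩ := hG
  rcases U.eq_empty_or_nonempty with rfl | hne
  · -- The empty set generates the trivial subgyrogroup, so it is itself suitable.
    refine ⟨_, Gyrogroup.isSuitableSet_of_converging (S := ∅) (fun W _ _ => ?_) ?_⟩
    · rw [Set.empty_sdiff]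
      exact Set.finite_empty
    · rw [hgen]
      exact dense_univ
  · have := Gyrogroup.locallyCompactSpace_of_isOpen hU hne hc
    have := Gyrogroup.sigmaCompactSpace_of_generated hne.closure hc subset_closure hgen
    have hgen' : Gyrogroup.generated (closure U) = Set.univ := Set.eq_univ_of_univ_subset <|
      hgen ▸ Gyrogroup.generated_subset (Gyrogroup.isSubgyrogroup_generated _)
        (subset_closure.trans (Gyrogroup.subset_generated _))
    obtain ⟨a, ha⟩ := Gyrogroup.Approximation.exists_conKer_eq_zero hc hgen'
    exact Gyrogroup.exists_isSuitableSet_of_approximation a ha
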